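/- Fix a real number $c \ge 1$. An $n$-node instance $(G,x,\mathrm{id})$ consists of a connected simple graph $G=(V,E)$ with $n$ nodes, pairwise distinct integer edge weights $w(e)\in[1,n^c]$, pairwise distinct integer node identities $\mathrm{id}(v)\in[1,n^c]$, and a label $x(v)$ at every node $v$, which is a (possibly empty) set of edges incident to $v$, such that every edge is either in the labels of both of its endpoints or in neither. Let $T_x$ be the subgraph formed by all edges in the labels. The instance satisfies $\mathrm{MST}$ if $T_x$ is a spanning tree of $G$ whose total weight is minimum among all spanning trees of $G$. For $t\ge 1$, a proof-labeling scheme of radius $t$ ($t$-PLS) for $\mathrm{MST}$ consists of a prover, which assigns to every node of every instance a bit string (its certificate), and a verifier, which decides at every node whether to accept, based only on what the node can learn in $t$ rounds of the LOCAL model: its own identity, the identities, labels and certificates of all nodes at distance at most $t$, and the edges, with their weights, that have an endpoint at distance less than $t$. It is required that (i) on every instance that satisfies $\mathrm{MST}$, all nodes accept with the certificates of the prover, and (ii) on every instance that does not satisfy $\mathrm{MST}$, for every assignment of certificates to the nodes, at least one node rejects. The verifier may depend on $t$ (and on fixed constants), but it is not given $n$. The certificate size of the scheme on $n$-node graphs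 is the maximum number of bits of a certificate assigned by the prover to a node of an $n$-node instance that satisfies $\mathrm{MST}$. Theorem. For every $t=O(\log n)$, the predicate $\mathrm{MST}$ has a $t$-PLS with certificates of $O(\log^2 n/t)$ bits. Precisely: for every $c\ge 1$ and every $a>0$ there is a constant $C>0$ such that for every integer $t\ge 1$ there is a $t$-PLS for $\mathrm{MST}$ (on graphs of all sizes) whose certificate size on $n$-node graphs is at most $C\,\log^2 n/t$ for every $n$ with $t\le a\log n$. -/

import Mathlib

/-- An instance `(G, x, id)` on `n` nodes: a connected simple graph with pairwise distinct integer
edge weights in `[1, n ^ c]`, with distinct identities in `[1, n ^ c]`, and with a label at every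
node `v` that is a set of edges incident to `v`, consistently chosen by the two endpoints of
every edge. Only the values of `weight` at edges of `graph` matter. -/
structure NetInstance (c : ℝ) (n : ℕ) where
  graph : SimpleGraph (Fin n)
  connected : graph.Connected
  weight : Sym2 (Fin n) → ℕ
  one_le_weight : ∀ e ∈ graph.edgeSet, 1 ≤ weight e
  weight_le : ∀ e ∈ graph.edgeSet, (weight e : ℝ) ≤ (n : ℝ) ^ c
  weight_injOn : Set.InjOn weight graph.edgeSet
  ident : Fin n → ℕ
  one_le_ident : ∀ v, 1 ≤ ident v
  ident_le : ∀ v, (ident v : ℝ) ≤ (n : ℝ) ^ c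
  ident_injective : Function.Injective ident
  label : Fin n → Set (Sym2 (Fin n))
  label_subset : ∀ v, label v ⊆ graph.incidenceSet v
  label_consistent : ∀ u v, s(u, v) ∈ label u ↔ s(u, v) ∈ label v

/-- The subgraph `T_x` formed by the edges that occur in the labels. -/
def NetInstance.marked {c : ℝ} {n : ℕ} (I : NetInstance c n) : SimpleGraph (Fin n) :=
  SimpleGraph.fromEdgeSet (⋃ v, I.label v)

open Classical in
/-- The total weight of a graph on the nodes of the instance. -/
noncomputable def NetInstance.totalWeight {c : ℝ} {n : ℕ} (I : NetInstance c n)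
    (T : SimpleGraph (Fin n)) : ℕ :=
  ∑ e ∈ T.edgeFinset, I.weight e

/-- `T` is a spanning tree of the graph of the instance. -/
def NetInstance.IsSpanningTree {c : ℝ} {n : ℕ} (I : NetInstance c n)
    (T : SimpleGraph (Fin n)) : Prop :=
  T ≤ I.graph ∧ T.IsTree

/-- A boolean predicate on labeled graphs with identities, of any number of nodes. -/
abbrev NetPredicate (c : ℝ) : Type := ∀ n : ℕ, NetInstance c n → Prop

/-- The predicate MST: the marked edges form a minimum-weight spanning tree. -/
def mst (c : ℝ) : NetPredicate c := fun _ I =>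
  I.IsSpanningTree I.marked ∧
    ∀ T, I.IsSpanningTree T → I.totalWeight I.marked ≤ I.totalWeight T

/-- What a node can know after some number of rounds, all nodes being named by their identities:
its own identity, a set of triples (identity, label, certificate) of nodes, and a set of pairs
(edge, weight of that edge). -/
structure LocalView where
  center : ℕ
  nodes : Set (ℕ × Set (Sym2 ℕ) × List Bool)
  edges : Set (Sym2 ℕ × ℕ)

/-- The view of node `v` after `t` rounds in the LOCAL model, with certificates `cert`: the
identities, labels and certificates of all nodes at distance at most `t`, and, with their weights,
the edges that have an endpoint at distance less than `t` (an edge that joins two nodes at distance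
exactly `t` is not yet known to `v`). The number of nodes of the graph is not part of it. -/
def NetInstance.view {c : ℝ} {n : ℕ} (I : NetInstance c n) (t : ℕ) (cert : Fin n → List Bool)
    (v : Fin n) : LocalView where
  center := I.ident v
  nodes := {p | ∃ u, I.graph.dist v u ≤ t ∧
    p = (I.ident u, Sym2.map I.ident '' I.label u, cert u)}
  edges := {q | ∃ u u', I.graph.Adj u u' ∧ I.graph.dist v u < t ∧
    q = (s(I.ident u, I.ident u'), I.weight s(u, u'))}

/-- A proof-labeling scheme of radius `t` for the predicate `P`, on graphs of every size. The
verifier tells for every view whether the node accepts it. -/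
structure ProofLabelingScheme {c : ℝ} (P : NetPredicate c) (t : ℕ) where
  prover : ∀ n : ℕ, NetInstance c n → Fin n → List Bool
  verifier : LocalView → Prop
  complete : ∀ (n : ℕ) (I : NetInstance c n), P n I →
    ∀ v, verifier (I.view t (prover n I) v)
  sound : ∀ (n : ℕ) (I : NetInstance c n), ¬ P n I →
    ∀ cert : Fin n → List Bool, ∃ v, ¬ verifier (I.view t cert v)

/-- The scheme has certificate size at most `b` on graphs with `n` nodes: on every instance with
`n` nodes that satisfies the predicate, all certificates of the prover have at most `b` bits. -/
def ProofLabelingScheme.SizeAtMost {c : ℝ} {P : NetPredicate c} {t : ℕ}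
    (S : ProofLabelingScheme P t) (n : ℕ) (b : ℝ) : Prop :=
  ∀ I : NetInstance c n, P n I → ∀ v, ((S.prover n I v).length : ℝ) ≤ b

/-! If weights are distinct, a spanning tree is minimum as soon as each of its edges is lightest
across some cut (`isMinTree_of_cuts`). The scheme certifies that the marked graph is a tree, by a
root identity and depths (`isTree_of_depth`), and exhibits such a cut for every marked edge.

For an edge `e` of the minimum tree, the tree edges lighter than `e` provide two cuts, namely the
components of its two endpoints. If one of them has fewer than `t` vertices, it lies inside the view
together with all edges leaving it, and no certificate is needed (`exists_local_cut`). The other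
edges are bulky. Deleting all bulky edges splits the tree into clusters, each with at least `t`
vertices if a bulky edge exists at all (`le_ncard_of_mem_bulkyEdges`).

Adding the bulky edges back by increasing weight merges components as in Kruskal's algorithm. Let
the cut of an edge be the smaller of the two components that it merges. A vertex lying in the cut
sees its component at least double, so it lies in at most log₂ n cuts (`exists_cut_family`). A cut
is named by the weight of its edge, and a vertex has to know the names of the cuts containing it.
Cuts are unions of clusters, so a whole cluster shares one list of names. The list is dealt into
about `t / 2` slices, each node stores one slice, and a colouring places every slice within distance
`t - 1` of every node of the cluster (`exists_dense_coloring`). A node thus stores O(log n / t)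
numbers of O(log n) bits.

For soundness nothing has to be honest: the nodes that read a weight `m` form some set, and checking
that all edges leaving it weigh at least `m` makes it a valid cut. -/

/-! ### Edge exchange and the cut criterion for minimum spanning trees -/

namespace SimpleGraph

variable {V : Type*} {G T : SimpleGraph V}

/-- Replacing an edge on the path of a tree between two nonadjacent vertices by the edge between
them gives a tree. -/
theorem IsTree.exchange (hT : T.IsTree) {a b : V} (hab : a ≠ b) (hn : ¬ T.Adj a b)
    {p : T.Walk a b} (hp : p.IsPath) {f : Sym2 V} (hf : f ∈ p.edges) :
    (T.deleteEdges {f} ⊔ edge a b).IsTree := by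
  classical
  have hfT : f ∈ T.edgeSet := p.edges_subset_edgeSet hf
  have hne : f ≠ s(a, b) := by rintro rfl; exact hn hfT
  have hsup : T.deleteEdges {f} ⊔ edge a b = (T ⊔ edge a b).deleteEdges {f} := by
    ext x y
    simp only [sup_adj, deleteEdges_adj, edge_adj, Set.mem_singleton_iff]
    constructor
    · rintro (⟨h, h'⟩ | ⟨h, h'⟩)
      · exact ⟨Or.inl h, h'⟩
      · refine ⟨Or.inr ⟨h, h'⟩, ?_⟩
        rintro rfl
        rcases h with ⟨rfl, rfl⟩ | ⟨rfl, rfl⟩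
        · exact hne rfl
        · exact hne Sym2.eq_swap
    · rintro ⟨h | h, h'⟩
      · exact Or.inl ⟨h, h'⟩
      · exact Or.inr h
  refine ⟨?_, ?_⟩
  · rw [hsup]
    have hc : (T ⊔ edge a b).Connected := hT.connected.mono le_sup_left
    have hadj : (T ⊔ edge a b).Adj b a := by simp [edge_adj, hab, hab.symm]
    let q : (T ⊔ edge a b).Walk a b := p.mapLe le_sup_left
    have hq : q.IsPath := hp.mapLe le_sup_left
    have hqe : q.edges = p.edges := p.edges_mapLe_eq_edges le_sup_left
    -- The new edge closes a cycle through `f`, so deleting `f` keeps the graph connected.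
    have hcyc : (Walk.cons hadj q).IsCycle := by
      refine Walk.cons_isCycle_iff q hadj |>.2 ⟨hq, fun h => ?_⟩
      rw [hqe] at h
      exact hn (Adj.symm (p.edges_subset_edgeSet h))
    obtain ⟨x, y⟩ := f
    refine hc.connected_delete_edge_of_not_isBridge fun hb => ?_
    exact hb.notMem_edges_of_isCycle hcyc (by simp [hqe, hf])
  · refine IsAcyclic.sup_edge_of_not_reachable ?_ (hT.isAcyclic.anti (deleteEdges_le _))
    rintro ⟨q⟩
    have hpq : p = q.bypass.mapLe (deleteEdges_le _) :=
      congrArg Subtype.val ((hT.isAcyclic.subsingleton_path a b).elim ⟨p, hp⟩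
        ⟨_, q.bypass_isPath.mapLe (deleteEdges_le {f})⟩)
    rw [hpq, Walk.edges_mapLe_eq_edges] at hf
    have := Walk.edges_subset_edgeSet _ hf
    simp at this

end SimpleGraph

namespace NetInstance

open SimpleGraph

variable {c : ℝ} {n : ℕ} (I : NetInstance c n)

/-- A spanning tree of minimum total weight. -/
def IsMinTree (T : SimpleGraph (Fin n)) : Prop :=
  I.IsSpanningTree T ∧ ∀ T', I.IsSpanningTree T' → I.totalWeight T ≤ I.totalWeight T'

theorem totalWeight_eq_sum {T : SimpleGraph (Fin n)} {s : Finset (Sym2 (Fin n))}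
    (h : ∀ e, e ∈ s ↔ e ∈ T.edgeSet) : I.totalWeight T = ∑ e ∈ s, I.weight e := by
  classical
  exact Finset.sum_congr (by ext e; simp [h]) fun _ _ => rfl

theorem totalWeight_mono {T T' : SimpleGraph (Fin n)} (h : T ≤ T') :
    I.totalWeight T ≤ I.totalWeight T' := by
  classical
  exact Finset.sum_le_sum_of_subset (by simpa using h)

theorem totalWeight_exchange {T : SimpleGraph (Fin n)} {a b : Fin n} {f : Sym2 (Fin n)}
    (hab : a ≠ b) (hn : ¬ T.Adj a b) (hf : f ∈ T.edgeSet) :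
    I.totalWeight (T.deleteEdges {f} ⊔ edge a b) + I.weight f
      = I.totalWeight T + I.weight s(a, b) := by
  classical
  have h1 : ∀ e, e ∈ insert s(a, b) (T.edgeFinset.erase f)
      ↔ e ∈ (T.deleteEdges {f} ⊔ edge a b).edgeSet := by
    intro e
    rw [iff_comm]
    induction e with | h x y =>
    simp only [mem_edgeFinset, mem_edgeSet, sup_adj, deleteEdges_adj, Set.mem_singleton_iff,
      edge_adj, Finset.mem_insert, Finset.mem_erase, Sym2.eq_iff]
    constructor
    · rintro (⟨h, h'⟩ | ⟨h, h'⟩)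
      · exact Or.inr ⟨h', h⟩
      · exact Or.inl (by tauto)
    · rintro (h | ⟨h, h'⟩)
      · refine Or.inr ⟨by tauto, ?_⟩
        rcases h with ⟨rfl, rfl⟩ | ⟨rfl, rfl⟩
        · exact hab
        · exact hab.symm
      · exact Or.inl ⟨h', h⟩
  rw [I.totalWeight_eq_sum h1, I.totalWeight_eq_sum (s := T.edgeFinset) (by simp),
    Finset.sum_insert (by simp [hn])]
  have h2 := Finset.sum_erase_add T.edgeFinset I.weight (mem_edgeFinset.2 hf)
  linarith

/-- Across every cut, the edges of a minimum spanning tree are the lightest. -/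
theorem IsMinTree.exists_le_of_cut {I : NetInstance c n} {T : SimpleGraph (Fin n)}
    (hT : I.IsMinTree T) (S : Set (Fin n)) {a b : Fin n} (hab : I.graph.Adj a b)
    (ha : a ∈ S) (hb : b ∉ S) :
    ∃ x y, T.Adj x y ∧ x ∈ S ∧ y ∉ S ∧ I.weight s(x, y) ≤ I.weight s(a, b) := by
  by_cases hn : T.Adj a b
  · exact ⟨a, b, hn, ha, hb, le_rfl⟩
  obtain ⟨p, hp⟩ := hT.1.2.connected.exists_isPath a b
  obtain ⟨d, hd, hd1, hd2⟩ := p.exists_boundary_dart S ha hb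
  have hde : s(d.fst, d.snd) ∈ p.edges := List.mem_map_of_mem (f := Dart.edge) hd
  refine ⟨d.fst, d.snd, d.adj, hd1, hd2, ?_⟩
  have h1 := I.totalWeight_exchange hab.ne hn (p.edges_subset_edgeSet hde)
  have h2 := hT.2 (T.deleteEdges {s(d.fst, d.snd)} ⊔ edge a b)
    ⟨sup_le ((deleteEdges_le _).trans hT.1.1) ((edge_le_iff _).2 (Or.inr hab)),
      hT.1.2.exchange hab.ne hn hp hde⟩
  omega

theorem exists_isMinTree : ∃ T, I.IsMinTree T := by
  obtain ⟨T₀, h₀, h₀'⟩ := I.connected.exists_isTree_le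
  obtain ⟨T, hT, hmin⟩ := Set.exists_min_image {T | I.IsSpanningTree T} I.totalWeight
    (Set.toFinite _) ⟨T₀, h₀, h₀'⟩
  exact ⟨T, hT, hmin⟩

/-- A spanning tree is minimum as soon as each of its edges is the lightest edge across some
cut. -/
theorem isMinTree_of_cuts {T : SimpleGraph (Fin n)} (hT : I.IsSpanningTree T)
    (h : ∀ a b, T.Adj a b → ∃ S : Set (Fin n), Xor (a ∈ S) (b ∈ S) ∧
      ∀ x y, I.graph.Adj x y → x ∈ S → y ∉ S → I.weight s(a, b) ≤ I.weight s(x, y)) :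
    I.IsMinTree T := by
  obtain ⟨T', hT'⟩ := I.exists_isMinTree
  -- Distinct weights force every edge of `T` into a fixed minimum tree; monotonicity of the weight
  -- then suffices.
  suffices hle : T ≤ T' from ⟨hT, fun T'' h'' => (I.totalWeight_mono hle).trans (hT'.2 T'' h'')⟩
  have key : ∀ a b, T.Adj a b → ∀ S : Set (Fin n), a ∈ S → b ∉ S →
      (∀ x y, I.graph.Adj x y → x ∈ S → y ∉ S → I.weight s(a, b) ≤ I.weight s(x, y)) →
      T'.Adj a b := by
    intro a b hab S ha hb hS
    obtain ⟨x, y, hxy, hx, hy, hle⟩ := hT'.exists_le_of_cut S (hT.1 hab) ha hb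
    have := I.weight_injOn (hT.1 hab) (hT'.1.1 hxy)
      (le_antisymm (hS x y (hT'.1.1 hxy) hx hy) hle)
    have h' : s(a, b) ∈ T'.edgeSet := this ▸ hxy
    exact h'
  intro a b hab
  obtain ⟨S, hx | hx, hS⟩ := h a b hab
  · exact key a b hab S hx.1 hx.2 hS
  · exact (key b a hab.symm S hx.1 hx.2 (by rwa [Sym2.eq_swap])).symm

end NetInstance

/-! ### Depth functions that certify trees -/

namespace SimpleGraph

variable {V : Type*}

/-- A depth function that changes by one along every edge and for which all vertices except one
have a unique lower neighbour certifies a tree. -/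
theorem isTree_of_depth [Finite V] [Nonempty V] {T : SimpleGraph V} (d : V → ℕ)
    (hzero : ∀ u v, d u = 0 → d v = 0 → u = v)
    (hstep : ∀ u v, T.Adj u v → d v + 1 = d u ∨ d v = d u + 1)
    (hparent : ∀ u, d u ≠ 0 → ∃! v, T.Adj u v ∧ d v + 1 = d u) : T.IsTree := by
  classical
  have := Fintype.ofFinite V
  have hdown : ∀ k u, d u = k → ∃ r, d r = 0 ∧ T.Reachable u r := by
    intro k
    induction k with
    | zero => exact fun u hu => ⟨u, hu, Reachable.refl u⟩
    | succ k ih =>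
      intro u hu
      obtain ⟨v, ⟨hv, hd⟩, -⟩ := hparent u (by omega)
      obtain ⟨r, hr, hvr⟩ := ih v (by omega)
      exact ⟨r, hr, hv.reachable.trans hvr⟩
  obtain ⟨r, hr, -⟩ := hdown _ (Classical.arbitrary V) rfl
  have hconn : T.Connected := by
    refine (connected_iff_exists_forall_reachable _).2 ⟨r, fun u => ?_⟩
    obtain ⟨r', hr', hu⟩ := hdown _ u rfl
    exact hzero r' r hr' hr ▸ hu.symm
  refine isTree_iff_connected_and_card.2 ⟨hconn,
    le_antisymm ?_ hconn.card_vert_le_card_edgeSet_add_one⟩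
  choose! par _ huniq using hparent
  -- Charging each edge to its deeper endpoint bounds the number of edges by that of the non-root
  -- vertices.
  have hsub : T.edgeFinset ⊆ (Finset.univ.erase r).image fun u => s(u, par u) := by
    intro e
    induction e with | h u v =>
    intro h
    have h : T.Adj u v := by simpa using h
    have key : ∀ u v, T.Adj u v → d v + 1 = d u →
        s(u, v) ∈ (Finset.univ.erase r).image fun u => s(u, par u) := by
      intro u v h hd
      have hu : d u ≠ 0 := by omega
      obtain rfl : v = par u := huniq u hu v ⟨h, hd⟩
      exact Finset.mem_image.2 ⟨u, by simpa using fun h : u = r => hu (h ▸ hr), rfl⟩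
    rcases hstep u v h with hd | hd
    · exact key u v h hd
    · rw [Sym2.eq_swap]
      exact key v u h.symm hd.symm
  have h1 := (Finset.card_le_card hsub).trans Finset.card_image_le
  rw [Finset.card_erase_of_mem (Finset.mem_univ _), Finset.card_univ] at h1
  have h2 : 0 < Fintype.card V := Fintype.card_pos
  rw [Nat.card_eq_fintype_card, ← edgeFinset_card, Nat.card_eq_fintype_card]
  omega

/-- In a tree, every vertex other than the root has a unique neighbour closer to the root. -/
theorem IsTree.existsUnique_parent {T : SimpleGraph V} (hT : T.IsTree) (r : V) {u : V}
    (hu : T.dist r u ≠ 0) : ∃! v, T.Adj u v ∧ T.dist r v + 1 = T.dist r u := by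
  obtain ⟨q, hq, hql⟩ := hT.connected.exists_path_of_dist r u
  have hnil : ¬ q.Nil := fun h => hu (by rw [← hql, Walk.length_eq_zero_iff.2 h])
  refine ⟨q.penultimate, ⟨(q.adj_penultimate hnil).symm, ?_⟩, ?_⟩
  · have h1 := dist_le q.dropLast
    have h2 := hT.dist_eq_dist_add_one_of_adj r (q.adj_penultimate hnil)
    have h3 : q.dropLast.length = q.length - 1 := by simp
    omega
  · rintro y ⟨hy, hd⟩
    obtain ⟨p, hp, hpl⟩ := hT.connected.exists_path_of_dist r y
    have hup : u ∉ p.support := by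
      intro h
      classical
      have h1 := dist_le (p.takeUntil u h)
      have h2 := p.length_takeUntil_le_length h
      omega
    have hyq := hT.isAcyclic.mem_support_of_ne_mem_support_of_adj_of_isPath hq hp hy hup
    exact hT.isAcyclic.eq_penultimate_of_adj_end hq hy hyq

/-! ### Distances in components and dense colourings -/

variable {H : SimpleGraph V}

/-- Distances inside a finite connected component are smaller than its number of vertices. -/
theorem Reachable.dist_lt_ncard [Finite V] {a x : V} (h : H.Reachable a x) :
    H.dist a x < {y | H.Reachable a y}.ncard := by
  classical
  obtain ⟨p, hp, hpl⟩ := h.exists_path_of_dist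
  rw [← hpl, ← Nat.succ_le_iff, ← Nat.add_one, ← p.length_support,
    ← List.toFinset_card_of_nodup hp.support_nodup, ← Set.ncard_coe_finset]
  refine Set.ncard_le_ncard (fun y hy => ?_) (Set.toFinite _)
  exact ⟨p.takeUntil y (by simpa using hy)⟩

/-- A shortest walk visits a vertex at every intermediate distance. -/
theorem Reachable.exists_dist_eq {r z : V} (h : H.Reachable r z) {i : ℕ} (hi : i ≤ H.dist r z) :
    ∃ y, H.Reachable r y ∧ H.dist r y = i ∧ H.dist y z = H.dist r z - i := by
  obtain ⟨p, hp⟩ := h.exists_walk_length_eq_dist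
  refine ⟨p.getVert i, ⟨p.take i⟩, ?_⟩
  have h1 := dist_le (p.take i)
  have h2 := dist_le (p.drop i)
  have h3 := (Walk.reachable (p.take i)).dist_triangle_left z
  rw [Walk.take_length] at h1
  rw [Walk.drop_length] at h2
  omega

/-- If some vertex has distance at least `k - 1` from `r`, colour by the distance to `r` modulo `k`:
deep vertices meet all colours on the way towards `r`, shallow ones go through `r` and then towards
the deep vertex. Otherwise any two vertices of the component are close, and `k` arbitrary vertices
receive the `k` colours. -/
theorem exists_coloring_component [Finite V] (k : ℕ) (r : V)
    (hcard : k ≤ {y | H.Reachable r y}.ncard) :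
    ∃ col : V → ℕ, ∀ x, H.Reachable r x → ∀ i < k,
      ∃ y, H.Reachable x y ∧ H.dist x y ≤ 2 * (k - 1) ∧ col y = i := by
  by_cases hz : ∃ z, H.Reachable r z ∧ k - 1 ≤ H.dist r z
  · obtain ⟨z, hrz, hz⟩ := hz
    refine ⟨fun y => H.dist r y % k, fun x hx i hi => ?_⟩
    by_cases hD : k - 1 ≤ H.dist r x
    · have hj : (H.dist r x - i) % k < k := Nat.mod_lt _ (by omega)
      obtain ⟨y, hry, h1, h2⟩ := hx.exists_dist_eq (i := H.dist r x - (H.dist r x - i) % k)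
        (Nat.sub_le _ _)
      refine ⟨y, hx.symm.trans hry, ?_, ?_⟩
      · rw [dist_comm, h2]; omega
      · show H.dist r y % k = i
        have h3 := Nat.div_add_mod (H.dist r x - i) k
        have h4 : H.dist r y = i + k * ((H.dist r x - i) / k) := by omega
        rw [h4, Nat.add_mul_mod_self_left, Nat.mod_eq_of_lt hi]
    · obtain ⟨y, hry, h1, -⟩ := hrz.exists_dist_eq (i := i) (by omega)
      refine ⟨y, hx.symm.trans hry, ?_, ?_⟩
      · have := hx.symm.dist_triangle_left y
        rw [dist_comm (u := x) (v := r)] at this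
        omega
      · show H.dist r y % k = i
        rw [h1, Nat.mod_eq_of_lt hi]
  · push Not at hz
    obtain ⟨s, hs, hsk⟩ := Set.exists_subset_card_eq hcard
    have hsf : s.Finite := Set.toFinite _
    obtain ⟨f, hf⟩ : ∃ f : Fin k → V, ∀ i, f i ∈ s ∧ ∀ j, f i = f j → i = j := by
      have e : Fin k ≃ s := (Finite.equivFinOfCardEq (by simpa using hsk)).symm
      exact ⟨fun i => e i, fun i => ⟨(e i).2, fun j h => e.injective (Subtype.ext h)⟩⟩
    have hfi : Function.Injective f := fun i j h => (hf i).2 j h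
    refine ⟨fun y => (Function.extend f (fun i => (i : ℕ)) 0) y, fun x hx i hi => ?_⟩
    have hr : H.Reachable r (f ⟨i, hi⟩) := hs (hf _).1
    refine ⟨f ⟨i, hi⟩, hx.symm.trans hr, ?_, hfi.extend_apply _ _ _⟩
    have h1 := hx.symm.dist_triangle_left (f ⟨i, hi⟩)
    rw [dist_comm (u := x) (v := r)] at h1
    have h2 := hz x hx
    have h3 := hz _ hr
    omega

/-- The vertices of a graph can be coloured so that in every component with at least `k` vertices
each of the first `k` colours occurs within distance `2 * (k - 1)` of every vertex. -/
theorem exists_dense_coloring [Finite V] (H : SimpleGraph V) (k : ℕ) :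
    ∃ col : V → ℕ, ∀ x, k ≤ {y | H.Reachable x y}.ncard → ∀ i < k,
      ∃ y, H.Reachable x y ∧ H.dist x y ≤ 2 * (k - 1) ∧ col y = i := by
  have h : ∀ C : H.ConnectedComponent, ∃ col : V → ℕ, ∀ x, H.connectedComponentMk x = C →
      k ≤ {y | H.Reachable x y}.ncard → ∀ i < k,
      ∃ y, H.Reachable x y ∧ H.dist x y ≤ 2 * (k - 1) ∧ col y = i := by
    intro C
    induction C using ConnectedComponent.ind with | h r =>
    by_cases hr : k ≤ {y | H.Reachable r y}.ncard
    · obtain ⟨col, hcol⟩ := exists_coloring_component k r hr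
      exact ⟨col, fun x hx _ => hcol x (ConnectedComponent.exact hx).symm⟩
    · refine ⟨0, fun x hx hk => (hr ?_).elim⟩
      have hxr := ConnectedComponent.exact hx
      have : {y | H.Reachable x y} = {y | H.Reachable r y} :=
        Set.ext fun y => ⟨hxr.symm.trans, hxr.trans⟩
      rwa [← this]
  choose col hcol using h
  refine ⟨fun y => col (H.connectedComponentMk y) y, fun x hx i hi => ?_⟩
  obtain ⟨y, hxy, hd, hy⟩ := hcol _ x rfl hx i hi
  exact ⟨y, hxy, hd, by simpa only [← ConnectedComponent.sound hxy] using hy⟩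

end SimpleGraph

/-! ### Bulky edges and the logarithmic family of cuts -/

namespace SimpleGraph

variable {V : Type*}

/-- The subgraph of the edges that are outside `B` or have weight less than `m`. -/
def lightPart (T : SimpleGraph V) (w : Sym2 V → ℕ) (B : Set (Sym2 V)) (m : ℕ) :
    SimpleGraph V where
  Adj x y := T.Adj x y ∧ (s(x, y) ∈ B → w s(x, y) < m)
  symm := ⟨fun x y h => ⟨h.1.symm, by rw [Sym2.eq_swap]; exact h.2⟩⟩
  loopless := ⟨fun x h => h.1.ne rfl⟩

variable {T : SimpleGraph V} {w : Sym2 V → ℕ} {B : Set (Sym2 V)}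

theorem lightPart_le (m : ℕ) : T.lightPart w B m ≤ T := fun _ _ h => h.1

theorem lightPart_mono {m m' : ℕ} (h : m ≤ m') : T.lightPart w B m ≤ T.lightPart w B m' :=
  fun _ _ hxy => ⟨hxy.1, fun hB => (hxy.2 hB).trans_le h⟩

/-- Only heavy edges of `B` leave a component of the light part. -/
theorem lightPart_boundary {m : ℕ} {a x y : V} (hx : (T.lightPart w B m).Reachable a x)
    (hy : ¬ (T.lightPart w B m).Reachable a y) (hxy : T.Adj x y) :
    s(x, y) ∈ B ∧ m ≤ w s(x, y) := by
  by_contra h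
  refine hy (hx.trans (Adj.reachable ⟨hxy, fun hB => ?_⟩))
  by_contra hlt
  exact h ⟨hB, not_lt.1 hlt⟩

theorem not_reachable_lightPart (hT : T.IsAcyclic) {m : ℕ} {a b : V} (hab : T.Adj a b)
    (hB : s(a, b) ∈ B) (hm : m ≤ w s(a, b)) : ¬ (T.lightPart w B m).Reachable a b := by
  intro h
  refine isBridge_iff.1 (isAcyclic_iff_forall_isBridge.1 hT hab) (h.mono ?_)
  intro x y hxy
  refine deleteEdges_adj.2 ⟨hxy.1, fun he => ?_⟩
  rw [Set.mem_singleton_iff] at he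
  have := hxy.2 (he ▸ hB)
  rw [he] at this
  omega

/-- The edges of a weighted tree both of whose sides, among the lighter edges, have at least `t`
vertices. -/
def bulkyEdges (T : SimpleGraph V) (w : Sym2 V → ℕ) (t : ℕ) : Set (Sym2 V) :=
  {e | ∀ a ∈ e, t ≤ {x | (T.lightPart w Set.univ (w e)).Reachable a x}.ncard}

/-- If a tree has a bulky edge, then the components that remain after the removal of all bulky
edges have at least `t` vertices. -/
theorem le_ncard_of_mem_bulkyEdges [Finite V] (hT : T.Connected) {t : ℕ} {e : Sym2 V}
    (he : e ∈ T.bulkyEdges w t) (x : V) :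
    t ≤ {y | (T.lightPart w (T.bulkyEdges w t) 0).Reachable x y}.ncard := by
  set K := {y | (T.lightPart w (T.bulkyEdges w t) 0).Reachable x y} with hK
  by_cases hcut : ∃ p : V × V, T.Adj p.1 p.2 ∧ p.1 ∈ K ∧ p.2 ∉ K
  -- Take the lightest tree edge leaving `K`. It is bulky, and strictly lighter edges cannot leave
  -- `K`, so its large inner side is contained in `K`.
  · obtain ⟨⟨a, b⟩, ⟨hab, ha, hb⟩, hmin⟩ := Set.exists_min_image
      {p : V × V | T.Adj p.1 p.2 ∧ p.1 ∈ K ∧ p.2 ∉ K} (fun p => w s(p.1, p.2))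
      (Set.toFinite _) hcut
    have hbulky := (lightPart_boundary ha hb hab).1
    refine (hbulky a (Sym2.mem_mk_left a b)).trans (Set.ncard_le_ncard ?_ (Set.toFinite _))
    rintro y ⟨p⟩
    by_contra hy
    obtain ⟨d, -, h1, h2⟩ := p.exists_boundary_dart K ha hy
    have h3 := d.adj.2 (Set.mem_univ _)
    exact absurd h3 (not_lt.2 (hmin (d.fst, d.snd) ⟨d.adj.1, h1, h2⟩))
  · have huniv : K = Set.univ := by
      refine Set.eq_univ_of_forall fun y => ?_
      by_contra hy
      obtain ⟨p⟩ := hT x y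
      obtain ⟨d, -, h1, h2⟩ := p.exists_boundary_dart K (Reachable.refl x) hy
      exact hcut ⟨(d.fst, d.snd), d.adj, h1, h2⟩
    induction e with | h a b =>
    rw [huniv]
    exact (he a (Sym2.mem_mk_left a b)).trans
      (Set.ncard_le_ncard (Set.subset_univ _) (Set.toFinite _))

/-- For every set `B` of edges of a weighted tree there are cuts, indexed by the weights, that do
not split the components of the complement of `B`, such that every edge in `B` is a lightest tree
edge across the cut of its weight, and such that no vertex is in more than logarithmically many
of the cuts. -/
theorem IsTree.exists_cut_family [Finite V] (hT : T.IsTree) (hw : Set.InjOn w T.edgeSet)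
    (B : Set (Sym2 V)) : ∃ S : ℕ → Set V,
      (∀ m x y, (T.lightPart w B 0).Adj x y → x ∈ S m → y ∈ S m) ∧
      (∀ m x y, T.Adj x y → x ∈ S m → y ∉ S m → m ≤ w s(x, y)) ∧
      (∀ x y, T.Adj x y → s(x, y) ∈ B → Xor (x ∈ S (w s(x, y))) (y ∈ S (w s(x, y)))) ∧
      (∀ m x, x ∈ S m → ∃ e ∈ T.edgeSet, e ∈ B ∧ w e = m) ∧
      (∀ x, ∀ s : Finset ℕ, (∀ m ∈ s, x ∈ S m) → 2 ^ s.card ≤ Nat.card V) := by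
  classical
  let D : ℕ → V → Set V := fun m a => {x | (T.lightPart w B m).Reachable a x}
  have hpick : ∀ e : Sym2 V, ∃ a ∈ e, ∀ b ∈ e, (D (w e) a).ncard ≤ (D (w e) b).ncard := by
    intro e
    induction e with | h a b =>
    rcases le_total (D (w s(a, b)) a).ncard (D (w s(a, b)) b).ncard with h | h
    · exact ⟨a, by simp, by simpa using h⟩
    · exact ⟨b, by simp, by simpa using h⟩
  choose pick hpick hpick_le using hpick
  let S : ℕ → Set V := fun m => {x | ∃ e ∈ T.edgeSet, e ∈ B ∧ w e = m ∧ x ∈ D m (pick e)}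
  -- Doubling: when the edge of weight `M` is added and `x` lies on its smaller side, the component
  -- of `x` absorbs a side at least as large.
  have hcard : ∀ x M, 2 ^ ((Finset.range M).filter (x ∈ S ·)).card ≤ (D M x).ncard := by
    intro x M
    induction M with
    | zero =>
      have : (D 0 x).Nonempty := ⟨x, Reachable.refl x⟩
      simpa using Nat.succ_le_iff.2 ((Set.ncard_pos (Set.toFinite _)).2 this)
    | succ M ih =>
      have hmono : ∀ a, D M a ⊆ D (M + 1) a := fun a y hy =>
        Reachable.mono (lightPart_mono (Nat.le_succ M)) hy
      rw [Finset.range_add_one, Finset.filter_insert]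
      split_ifs with hx
      · obtain ⟨e, heT, heB, rfl, hx⟩ := hx
        obtain ⟨b, hb⟩ := Sym2.mem_iff_exists.1 (hpick e)
        have hab : T.Adj (pick e) b := by rw [← mem_edgeSet, ← hb]; exact heT
        have hle : (D (w e) (pick e)).ncard ≤ (D (w e) b).ncard :=
          hpick_le e b (by rw [hb]; exact Sym2.mem_mk_right _ _)
        have hxa : D (w e) x = D (w e) (pick e) :=
          Set.ext fun y => ⟨fun h => hx.trans h, fun h => hx.symm.trans h⟩
        have hdisj : Disjoint (D (w e) (pick e)) (D (w e) b) := by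
          refine Set.disjoint_left.2 fun y h1 h2 => ?_
          exact not_reachable_lightPart hT.isAcyclic hab (hb ▸ heB) (hb ▸ le_rfl)
            (Reachable.trans h1 (Reachable.symm h2))
        have hadj : (T.lightPart w B (w e + 1)).Adj (pick e) b :=
          ⟨hab, fun _ => by rw [← hb]; exact Nat.lt_succ_self _⟩
        have hxa' : (T.lightPart w B (w e + 1)).Reachable x (pick e) :=
          Reachable.symm (hmono _ hx)
        have hsub : D (w e) (pick e) ∪ D (w e) b ⊆ D (w e + 1) x := by
          rintro y (hy | hy)
          · exact hxa'.trans (hmono _ hy)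
          · exact (hxa'.trans hadj.reachable).trans (hmono _ hy)
        have h1 := Set.ncard_le_ncard hsub (Set.toFinite _)
        rw [Set.ncard_union_eq hdisj (Set.toFinite _) (Set.toFinite _)] at h1
        rw [Finset.card_insert_of_notMem (by simp), pow_succ]
        rw [hxa] at ih
        omega
      · exact ih.trans (Set.ncard_le_ncard (hmono x) (Set.toFinite _))
  refine ⟨S, ?_, ?_, ?_, ?_, ?_⟩
  · rintro m x y hxy ⟨e, h1, h2, h3, h4⟩
    exact ⟨e, h1, h2, h3,
      h4.trans (Adj.reachable (lightPart_mono (Nat.zero_le m) hxy))⟩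
  · rintro m x y hxy ⟨e, h1, h2, h3, h4⟩ hy
    exact (lightPart_boundary h4 (fun h => hy ⟨e, h1, h2, h3, h⟩) hxy).2
  · intro x y hxy hB
    have hS : ∀ z, z ∈ S (w s(x, y)) ↔ z ∈ D (w s(x, y)) (pick s(x, y)) := by
      intro z
      refine ⟨?_, fun h => ⟨_, hxy, hB, rfl, h⟩⟩
      rintro ⟨e, h1, h2, h3, h4⟩
      rwa [hw h1 hxy h3] at h4
    have hnr := not_reachable_lightPart (w := w) hT.isAcyclic hxy hB le_rfl
    rcases Sym2.mem_iff.1 (hpick s(x, y)) with h | h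
    · refine Or.inl ⟨(hS x).2 ?_, fun hy => hnr ?_⟩
      · rw [h]; exact Reachable.refl x
      · have := (hS y).1 hy
        rwa [h] at this
    · refine Or.inr ⟨(hS y).2 ?_, fun hx => hnr ?_⟩
      · rw [h]; exact Reachable.refl y
      · have := (hS x).1 hx
        rw [h] at this
        exact Reachable.symm this
  · rintro m x ⟨e, h1, h2, h3, -⟩
    exact ⟨e, h1, h2, h3⟩
  · intro x s hs
    obtain ⟨M, hM⟩ := s.exists_nat_subset_range
    calc 2 ^ s.card ≤ 2 ^ ((Finset.range M).filter (x ∈ S ·)).card :=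
          Nat.pow_le_pow_right (by norm_num) (Finset.card_le_card fun m hm =>
            Finset.mem_filter.2 ⟨hM hm, hs m hm⟩)
      _ ≤ (D M x).ncard := hcard x M
      _ ≤ Nat.card V := Set.ncard_le_card _

end SimpleGraph

/-! ### Binary encoding of certificates -/

/-- A self-delimiting binary code of the natural numbers. -/
def Nat.selfDelimiting (m : ℕ) : List Bool := m.bits.flatMap (fun b => [true, b]) ++ [false]

theorem Nat.length_selfDelimiting (m : ℕ) : m.selfDelimiting.length = 2 * m.size + 1 := by
  have h : ∀ l : List Bool, (l.flatMap fun b => [true, b]).length = 2 * l.length := by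
    intro l
    induction l with
    | nil => rfl
    | cons b l ih => rw [List.flatMap_cons, List.length_append, ih]; simp; ring
  rw [Nat.selfDelimiting, List.length_append, h, Nat.size_eq_bits_len]
  rfl

/-- Each bit is preceded by the flag `true`, and a `false` in flag position ends the number, so the
code is prefix-free. -/
theorem Nat.selfDelimiting_append_inj {m m' : ℕ} {r r' : List Bool}
    (h : m.selfDelimiting ++ r = m'.selfDelimiting ++ r') : m = m' ∧ r = r' := by
  have key : ∀ l l' : List Bool, (l.flatMap fun b => [true, b]) ++ [false] ++ r
      = (l'.flatMap fun b => [true, b]) ++ [false] ++ r' → l = l' ∧ r = r' := by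
    intro l
    induction l with
    | nil => intro l'; cases l' <;> simp
    | cons b l ih =>
      intro l' h'
      cases l' with
      | nil => simp at h'
      | cons b' l' =>
        simp only [List.flatMap_cons, List.cons_append, List.nil_append, List.cons.injEq,
          true_and] at h'
        obtain ⟨h1, h2⟩ := ih l' h'.2
        exact ⟨by rw [h'.1, h1], h2⟩
  obtain ⟨h1, h2⟩ := key _ _ h
  exact ⟨Nat.digits.injective 2 (by simp only [Nat.digits_two_eq_bits, h1]), h2⟩

theorem Nat.flatMap_selfDelimiting_injective :
    Function.Injective fun l : List ℕ => l.flatMap Nat.selfDelimiting := by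
  intro l
  induction l with
  | nil =>
    rintro (_ | ⟨m, l'⟩) h
    · rfl
    · have := congrArg List.length h
      simp only [List.flatMap_nil, List.flatMap_cons, List.length_append, List.length_nil,
        Nat.length_selfDelimiting] at this
      omega
  | cons m l ih =>
    rintro (_ | ⟨m', l'⟩) h
    · have := congrArg List.length h
      simp [Nat.length_selfDelimiting] at this
    · obtain ⟨rfl, h'⟩ := Nat.selfDelimiting_append_inj
        (by simpa only [List.flatMap_cons] using h)
      rw [ih h']

/-- The content of a certificate: identity of the root of the spanning tree, depth in the tree,
name of the cluster of the node, and some weights of edges. -/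
structure MstCertificate where
  root : ℕ
  depth : ℕ
  cluster : ℕ
  cuts : List ℕ

namespace MstCertificate

def encode (d : MstCertificate) : List Bool :=
  (d.root :: d.depth :: d.cluster :: d.cuts).flatMap Nat.selfDelimiting

theorem encode_injective : Function.Injective encode := by
  rintro ⟨_, _, _, _⟩ ⟨_, _, _, _⟩ h
  have := Nat.flatMap_selfDelimiting_injective h
  simp only [List.cons.injEq] at this
  obtain ⟨rfl, rfl, rfl, rfl⟩ := this
  rfl

instance : Nonempty MstCertificate := ⟨⟨0, 0, 0, []⟩⟩

/-- Total on purpose: a malformed string decodes to an arbitrary certificate, which is harmless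
since soundness holds for all contents. -/
noncomputable def decode : List Bool → MstCertificate := Function.invFun encode

theorem decode_encode (d : MstCertificate) : decode d.encode = d :=
  Function.leftInverse_invFun encode_injective d

theorem length_encode_le (d : MstCertificate) {b : ℕ} (hroot : d.root.size ≤ b)
    (hdepth : d.depth.size ≤ b) (hcluster : d.cluster.size ≤ b)
    (hcuts : ∀ m ∈ d.cuts, m.size ≤ b) :
    d.encode.length ≤ (d.cuts.length + 3) * (2 * b + 1) := by
  have h : ∀ l : List ℕ, (∀ m ∈ l, m.size ≤ b) →
      (l.flatMap Nat.selfDelimiting).length ≤ l.length * (2 * b + 1) := by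
    intro l hl
    induction l with
    | nil => simp
    | cons m l ih =>
      have h1 := ih fun m' hm' => hl m' (List.mem_cons_of_mem _ hm')
      have h2 := hl m List.mem_cons_self
      rw [List.flatMap_cons, List.length_append, Nat.length_selfDelimiting, List.length_cons]
      linarith
  have := h (d.root :: d.depth :: d.cluster :: d.cuts) (by
    intro m hm
    simp only [List.mem_cons] at hm
    rcases hm with rfl | rfl | rfl | hm
    exacts [hroot, hdepth, hcluster, hcuts m hm])
  exact this

end MstCertificate

/-! ### The verifier -/

namespace LocalView

/-- The nodes that can be reached from `x` through at most `r` visible edges. -/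
def ball (V : LocalView) (x : ℕ) : ℕ → Set ℕ
  | 0 => {x}
  | r + 1 => V.ball x r ∪ {z | ∃ y ∈ V.ball x r, ∃ w, (s(y, z), w) ∈ V.edges}

open Classical in
/-- The content of the certificate of the node with identity `x`. -/
noncomputable def certificate (V : LocalView) (x : ℕ) : MstCertificate :=
  if h : ∃ l L, (x, L, l) ∈ V.nodes then .decode h.choose else .decode []

/-- The edge between the center and `y` is marked. -/
def Marked (V : LocalView) (y : ℕ) : Prop :=
  ∃ L l, (V.center, L, l) ∈ V.nodes ∧ s(V.center, y) ∈ L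

/-- The weights stored in the part of the cluster of `x` that is near `x`. -/
def cuts (V : LocalView) (t x : ℕ) : Set ℕ :=
  {m | ∃ y ∈ V.ball x (t - 1), (V.certificate y).cluster = (V.certificate x).cluster ∧
    m ∈ (V.certificate y).cuts}

/-- The verifier: the marked edges form a tree, and every marked edge at the center is a lightest
edge across a cut that is either given by the certificates or contained in the view. -/
structure AcceptsMst (t : ℕ) (V : LocalView) : Prop where
  root_eq : ∀ y w, (s(V.center, y), w) ∈ V.edges →
    (V.certificate y).root = (V.certificate V.center).root
  root_center : (V.certificate V.center).depth = 0 → (V.certificate V.center).root = V.center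
  depth_step : ∀ y, V.Marked y →
    (V.certificate y).depth + 1 = (V.certificate V.center).depth ∨
      (V.certificate y).depth = (V.certificate V.center).depth + 1
  parent : (V.certificate V.center).depth ≠ 0 →
    ∃! y, V.Marked y ∧ (V.certificate y).depth + 1 = (V.certificate V.center).depth
  cut_le : ∀ y w, (s(V.center, y), w) ∈ V.edges →
    ∀ m ∈ V.cuts t V.center, m ∉ V.cuts t y → m ≤ w
  covered : ∀ y w, (s(V.center, y), w) ∈ V.edges → V.Marked y →
    Xor (w ∈ V.cuts t V.center) (w ∈ V.cuts t y) ∨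
      ∃ S ⊆ V.ball V.center (t - 1), Xor (V.center ∈ S) (y ∈ S) ∧
        ∀ x z w', (s(x, z), w') ∈ V.edges → x ∈ S → z ∉ S → w ≤ w'

end LocalView

/-! ### From views to the instance, and soundness -/

namespace NetInstance

variable {c : ℝ} {n : ℕ} {I : NetInstance c n} {t : ℕ} {cert : Fin n → List Bool} {v : Fin n}

theorem mem_view_edges {u : Fin n} {y w : ℕ} :
    (s(I.ident u, y), w) ∈ (I.view t cert v).edges ↔ ∃ u', y = I.ident u' ∧ I.graph.Adj u u' ∧
      (I.graph.dist v u < t ∨ I.graph.dist v u' < t) ∧ w = I.weight s(u, u') := by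
  constructor
  · rintro ⟨a, b, hab, hd, he⟩
    rw [Prod.mk.injEq, Sym2.eq_iff] at he
    obtain ⟨⟨h1, h2⟩ | ⟨h1, h2⟩, hw⟩ := he
    · obtain rfl := I.ident_injective h1
      exact ⟨b, h2, hab, Or.inl hd, hw⟩
    · obtain rfl := I.ident_injective h1
      exact ⟨a, h2, hab.symm, Or.inr hd, by rwa [Sym2.eq_swap]⟩
  · rintro ⟨u', rfl, hadj, hd | hd, rfl⟩
    · exact ⟨u, u', hadj, hd, rfl⟩
    · exact ⟨u', u, hadj.symm, hd, by rw [Sym2.eq_swap, Sym2.eq_swap (a := u)]⟩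

/-- The bound on `r` keeps shortest paths visible: each of their edges has an endpoint at distance
less than `t` from `v`. -/
theorem mem_view_ball {x : Fin n} {r : ℕ} (hr : I.graph.dist v x + r ≤ t) {z : ℕ} :
    z ∈ (I.view t cert v).ball (I.ident x) r ↔ ∃ u, z = I.ident u ∧ I.graph.dist x u ≤ r := by
  induction r generalizing z with
  | zero =>
    simp only [LocalView.ball, Set.mem_singleton_iff, Nat.le_zero, I.connected.dist_eq_zero_iff]
    exact ⟨fun h => ⟨x, h, rfl⟩, by rintro ⟨u, h, rfl⟩; exact h⟩
  | succ r ih =>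
    have ih := @ih (by omega)
    simp only [LocalView.ball, Set.mem_union, Set.mem_ofPred_eq]
    constructor
    · rintro (h | ⟨y, hy, w, hw⟩)
      · obtain ⟨u, hu, hd⟩ := ih.1 h
        exact ⟨u, hu, by omega⟩
      · obtain ⟨u, rfl, hd⟩ := ih.1 hy
        obtain ⟨u', rfl, hadj, -, -⟩ := mem_view_edges.1 hw
        have h1 := I.connected.dist_triangle (u := x) (v := u) (w := u')
        have h2 := SimpleGraph.dist_eq_one_iff_adj.2 hadj
        exact ⟨u', rfl, by omega⟩
    · rintro ⟨u, rfl, hd⟩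
      rcases Nat.lt_or_ge r (I.graph.dist x u) with h | h
      · obtain ⟨y, -, h1, h2⟩ := (I.connected x u).exists_dist_eq h.le
        have hadj : I.graph.Adj y u := SimpleGraph.dist_eq_one_iff_adj.1 (by omega)
        have h3 := I.connected.dist_triangle (u := v) (v := x) (w := y)
        exact Or.inr ⟨I.ident y, ih.2 ⟨y, rfl, h1.le⟩, _,
          mem_view_edges.2 ⟨u, rfl, hadj, Or.inl (by omega), rfl⟩⟩
      · exact Or.inl (ih.2 ⟨u, rfl, h⟩)

theorem view_certificate {u : Fin n} (hu : I.graph.dist v u ≤ t) :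
    (I.view t cert v).certificate (I.ident u) = .decode (cert u) := by
  have h : ∃ l L, (I.ident u, L, l) ∈ (I.view t cert v).nodes := ⟨_, _, u, hu, rfl⟩
  rw [LocalView.certificate, dif_pos h]
  obtain ⟨L, u', -, h'⟩ := h.choose_spec
  simp only [Prod.mk.injEq] at h'
  obtain rfl := I.ident_injective h'.1
  rw [h'.2.2]

theorem marked_adj {u : Fin n} : I.marked.Adj v u ↔ s(v, u) ∈ I.label v := by
  rw [marked, SimpleGraph.fromEdgeSet_adj, Set.mem_iUnion]
  constructor
  · rintro ⟨⟨z, hz⟩, -⟩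
    rcases Sym2.mem_iff.1 (I.label_subset z hz).2 with rfl | rfl
    · exact hz
    · exact (I.label_consistent _ _).2 hz
  · intro h
    exact ⟨⟨v, h⟩, SimpleGraph.Adj.ne (I.label_subset v h).1⟩

theorem marked_le : I.marked ≤ I.graph := fun v _ h => (I.label_subset v (marked_adj.1 h)).1

theorem view_marked {y : ℕ} :
    (I.view t cert v).Marked y ↔ ∃ u, y = I.ident u ∧ I.marked.Adj v u := by
  constructor
  · rintro ⟨L, l, ⟨v', -, h⟩, hL⟩
    simp only [view, Prod.mk.injEq] at h
    obtain ⟨h1, rfl, -⟩ := h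
    obtain rfl := I.ident_injective h1
    obtain ⟨e, he, hey⟩ := hL
    obtain ⟨u, rfl⟩ := Sym2.mem_iff_exists.1 (I.label_subset v he).2
    exact ⟨u, (Sym2.congr_right.1 hey).symm, marked_adj.2 he⟩
  · rintro ⟨u, rfl, h⟩
    exact ⟨_, _, ⟨v, by simp, rfl⟩, s(v, u), marked_adj.1 h, rfl⟩

/-- The weights stored in the part of the cluster of `v` that is near `v`. -/
def cuts (I : NetInstance c n) (t : ℕ) (f : Fin n → MstCertificate) (v : Fin n) : Set ℕ :=
  {m | ∃ y, I.graph.dist v y ≤ t - 1 ∧ (f y).cluster = (f v).cluster ∧ m ∈ (f y).cuts}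

/-- Used for the center and its neighbours. Collecting weights only up to radius `t - 1` is what
lets a node evaluate the sets of its neighbours too. -/
theorem view_cuts {x : Fin n} (hx : I.graph.dist v x + (t - 1) ≤ t) :
    (I.view t cert v).cuts t (I.ident x) = I.cuts t (fun u => .decode (cert u)) x := by
  ext m
  simp only [LocalView.cuts, cuts, Set.mem_ofPred_eq, mem_view_ball hx]
  rw [view_certificate (by omega)]
  constructor
  · rintro ⟨_, ⟨u, rfl, hd⟩, h⟩
    have := I.connected.dist_triangle (u := v) (v := x) (w := u)
    rw [view_certificate (by omega)] at h
    exact ⟨u, hd, h⟩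
  · rintro ⟨u, hd, h⟩
    have := I.connected.dist_triangle (u := v) (v := x) (w := u)
    refine ⟨_, ⟨u, rfl, hd⟩, ?_⟩
    rwa [view_certificate (by omega)]

/-- The condition checked by the verifier, in terms of the instance. -/
structure LocallyMst (I : NetInstance c n) (t : ℕ) (f : Fin n → MstCertificate)
    (v : Fin n) : Prop where
  root_eq : ∀ u, I.graph.Adj v u → (f u).root = (f v).root
  root_center : (f v).depth = 0 → (f v).root = I.ident v
  depth_step : ∀ u, I.marked.Adj v u →
    (f u).depth + 1 = (f v).depth ∨ (f u).depth = (f v).depth + 1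
  parent : (f v).depth ≠ 0 → ∃! u, I.marked.Adj v u ∧ (f u).depth + 1 = (f v).depth
  cut_le : ∀ u, I.graph.Adj v u → ∀ m ∈ I.cuts t f v, m ∉ I.cuts t f u → m ≤ I.weight s(v, u)
  covered : ∀ u, I.marked.Adj v u →
    Xor (I.weight s(v, u) ∈ I.cuts t f v) (I.weight s(v, u) ∈ I.cuts t f u) ∨
      ∃ S : Set (Fin n), (∀ x ∈ S, I.graph.dist v x < t) ∧ Xor (v ∈ S) (u ∈ S) ∧
        ∀ x y, I.graph.Adj x y → x ∈ S → y ∉ S → I.weight s(v, u) ≤ I.weight s(x, y)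

theorem acceptsMst_view_iff (ht : 1 ≤ t) :
    (I.view t cert v).AcceptsMst t ↔ I.LocallyMst t (fun u => .decode (cert u)) v := by
  have hcenter : (I.view t cert v).center = I.ident v := rfl
  have hedge : ∀ {y w}, (s(I.ident v, y), w) ∈ (I.view t cert v).edges ↔
      ∃ u, y = I.ident u ∧ I.graph.Adj v u ∧ w = I.weight s(v, u) := by
    intro y w
    rw [mem_view_edges]
    simp only [SimpleGraph.dist_self, Nat.lt_of_lt_of_le Nat.zero_lt_one ht, true_or, true_and]
  have hcv : (I.view t cert v).certificate (I.ident v) = .decode (cert v) :=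
    view_certificate (by simp)
  have hadj : ∀ {u}, I.graph.Adj v u → I.graph.dist v u = 1 :=
    fun h => SimpleGraph.dist_eq_one_iff_adj.2 h
  have hcu : ∀ {u}, I.graph.Adj v u →
      (I.view t cert v).certificate (I.ident u) = .decode (cert u) :=
    fun h => view_certificate (by rw [hadj h]; exact ht)
  have hSv : (I.view t cert v).cuts t (I.ident v) = I.cuts t (fun u => .decode (cert u)) v :=
    view_cuts (by rw [SimpleGraph.dist_self]; omega)
  have hSu : ∀ {u}, I.graph.Adj v u →
      (I.view t cert v).cuts t (I.ident u) = I.cuts t (fun u => .decode (cert u)) u :=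
    fun h => view_cuts (by rw [hadj h]; omega)
  have hball : ∀ {z}, z ∈ (I.view t cert v).ball (I.ident v) (t - 1) ↔
      ∃ u, z = I.ident u ∧ I.graph.dist v u ≤ t - 1 :=
    mem_view_ball (by rw [SimpleGraph.dist_self]; omega)
  constructor
  · rintro ⟨h1, h2, h3, h4, h5, h6⟩
    rw [hcenter] at h1 h2 h3 h4 h5 h6
    rw [hcv] at h1 h2 h3 h4
    refine ⟨fun u hu => ?_, h2, fun u hu => ?_, fun hd => ?_, fun u hu => ?_, fun u hu => ?_⟩
    · rw [← h1 _ _ (hedge.2 ⟨u, rfl, hu, rfl⟩), hcu hu]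
    · have := h3 _ (view_marked.2 ⟨u, rfl, hu⟩)
      rwa [hcu (marked_le hu)] at this
    · obtain ⟨y, ⟨hy, hyd⟩, huniq⟩ := h4 hd
      obtain ⟨u, rfl, hu⟩ := view_marked.1 hy
      rw [hcu (marked_le hu)] at hyd
      refine ⟨u, ⟨hu, hyd⟩, ?_⟩
      rintro u' ⟨hu', hd'⟩
      exact I.ident_injective (huniq _ ⟨view_marked.2 ⟨u', rfl, hu'⟩, by
        rwa [hcu (marked_le hu')]⟩)
    · have := h5 _ _ (hedge.2 ⟨u, rfl, hu, rfl⟩)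
      rwa [hSv, hSu hu] at this
    · rcases h6 _ _ (hedge.2 ⟨u, rfl, marked_le hu, rfl⟩) (view_marked.2 ⟨u, rfl, hu⟩) with
        h | ⟨S, hS, hx, hle⟩
      · rw [hSv, hSu (marked_le hu)] at h
        exact Or.inl h
      -- Since `S` stays within radius `t - 1`, every edge leaving it is visible, so no lighter one
      -- can be missed.
      · refine Or.inr ⟨I.ident ⁻¹' S, fun x hx => ?_, hx, fun x y hxy hxS hyS => ?_⟩
        · obtain ⟨x', hx', hd⟩ := hball.1 (hS hx)
          obtain rfl := I.ident_injective hx'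
          omega
        · obtain ⟨x', hx', hd⟩ := hball.1 (hS hxS)
          obtain rfl := I.ident_injective hx'
          exact hle _ _ _ (mem_view_edges.2 ⟨y, rfl, hxy, Or.inl (by omega), rfl⟩) hxS hyS
  · rintro ⟨h1, h2, h3, h4, h5, h6⟩
    refine ⟨?_, ?_, ?_, ?_, ?_, ?_⟩ <;> rw [hcenter]
    · intro y w hyw
      obtain ⟨u, rfl, hu, -⟩ := hedge.1 hyw
      rw [hcu hu, hcv]
      exact h1 u hu
    · rwa [hcv]
    · intro y hy
      obtain ⟨u, rfl, hu⟩ := view_marked.1 hy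
      rw [hcv, hcu (marked_le hu)]
      exact h3 u hu
    · rw [hcv]
      intro hd
      obtain ⟨u, ⟨hu, hud⟩, huniq⟩ := h4 hd
      refine ⟨I.ident u, ⟨view_marked.2 ⟨u, rfl, hu⟩, by rwa [hcu (marked_le hu)]⟩, ?_⟩
      rintro _ ⟨hy, hyd⟩
      obtain ⟨u', rfl, hu'⟩ := view_marked.1 hy
      rw [hcu (marked_le hu')] at hyd
      rw [huniq u' ⟨hu', hyd⟩]
    · intro y w hyw
      obtain ⟨u, rfl, hu, rfl⟩ := hedge.1 hyw
      rw [hSv, hSu hu]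
      exact h5 u hu
    · intro y w hyw hy
      obtain ⟨u, rfl, hu, rfl⟩ := hedge.1 hyw
      obtain ⟨u', hu', hm⟩ := view_marked.1 hy
      obtain rfl := I.ident_injective hu'
      rw [hSv, hSu hu]
      refine (h6 u hm).imp_right ?_
      rintro ⟨S, hS, hx, hle⟩
      have himg : ∀ z, I.ident z ∈ I.ident '' S ↔ z ∈ S := fun z =>
        I.ident_injective.mem_set_image
      refine ⟨I.ident '' S, ?_, by rwa [himg, himg], ?_⟩
      · rintro _ ⟨x, hx, rfl⟩
        exact hball.2 ⟨x, rfl, by have := hS x hx; omega⟩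
      · rintro _ z w' he ⟨x, hx, rfl⟩ hz
        obtain ⟨z, rfl, hxz, -, rfl⟩ := mem_view_edges.1 he
        exact hle x z hxz hx (by rwa [himg] at hz)

/-- Instances that are accepted by all nodes satisfy the predicate. -/
theorem mst_of_locallyMst {f : Fin n → MstCertificate} (h : ∀ v, I.LocallyMst t f v) :
    mst c n I := by
  have hroot : ∀ u v, (f u).root = (f v).root := by
    intro u v
    obtain ⟨p⟩ := I.connected u v
    induction p with
    | nil => rfl
    | cons hadj _ ih => exact ((h _).root_eq _ hadj).symm.trans ih
  have : Nonempty (Fin n) := I.connected.nonempty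
  have htree : I.marked.IsTree := by
    refine SimpleGraph.isTree_of_depth (fun v => (f v).depth) (fun u v hu hv => ?_)
      (fun u => (h u).depth_step) (fun u => (h u).parent)
    apply I.ident_injective
    rw [← (h u).root_center hu, ← (h v).root_center hv, hroot]
  refine I.isMinTree_of_cuts ⟨marked_le, htree⟩ fun a b hab => ?_
  rcases (h a).covered b hab with hx | ⟨S, -, hx, hS⟩
  -- The cut consists of the nodes that read this weight, whether or not the cluster names are
  -- truthful.
  · exact ⟨{v | I.weight s(a, b) ∈ I.cuts t f v}, hx, fun x y hxy hx hy =>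
      (h x).cut_le y hxy _ hx hy⟩
  · exact ⟨S, hx, hS⟩

end NetInstance

/-! ### Slicing the lists of weights, and completeness -/

/-- The elements of all finite sets of numbers can be distributed evenly into `k` slices. -/
theorem Finset.exists_slices (k : ℕ) (hk : 1 ≤ k) : ∃ g : Finset ℕ → ℕ → ℕ,
    (∀ s m, g s m < k) ∧ ∀ (s : Finset ℕ) i, (s.filter (g s · = i)).card ≤ s.card / k + 1 := by
  -- Elements are dealt by rank modulo `k`; inside one slice the quotient of the rank by `k`
  -- determines the element.
  let rank : Finset ℕ → ℕ → ℕ := fun s m => (s.filter (· < m)).card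
  have hmono : ∀ s : Finset ℕ, ∀ m ∈ s, ∀ m', m < m' → rank s m < rank s m' := by
    intro s m hm m' h
    refine Finset.card_lt_card ⟨fun a ha => ?_, fun hsub => ?_⟩
    · rw [Finset.mem_filter] at ha ⊢
      exact ⟨ha.1, ha.2.trans h⟩
    · have := hsub (Finset.mem_filter.2 ⟨hm, h⟩)
      simp at this
  refine ⟨fun s m => rank s m % k, fun s m => Nat.mod_lt _ hk, fun s i => ?_⟩
  rw [← Finset.card_range (s.card / k + 1)]
  refine Finset.card_le_card_of_injOn (fun m => rank s m / k) (fun m _ => ?_) ?_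
  · rw [Finset.coe_range, Set.mem_Iio, Nat.lt_succ_iff]
    exact Nat.div_le_div_right (Finset.card_le_card (Finset.filter_subset _ _))
  · intro m hm m' hm' h
    simp only [Finset.coe_filter, Set.mem_ofPred_eq] at hm hm' h
    have hr : rank s m = rank s m' := by
      rw [← Nat.div_add_mod (rank s m) k, ← Nat.div_add_mod (rank s m') k, h, hm.2, hm'.2]
    rcases lt_trichotomy m m' with hlt | heq | hlt
    · exact absurd hr (hmono s m hm.1 m' hlt).ne
    · exact heq
    · exact absurd hr (hmono s m' hm'.1 m hlt).ne'

namespace NetInstance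

open SimpleGraph

variable {c : ℝ} {n : ℕ} {I : NetInstance c n} {t : ℕ}

/-- On an edge of a minimum spanning tree that is not bulky, some cut near both endpoints shows
that the edge is lightest. -/
theorem IsMinTree.exists_local_cut {T : SimpleGraph (Fin n)} (hT : I.IsMinTree T) {v u : Fin n}
    (hvu : T.Adj v u) (he : s(v, u) ∉ T.bulkyEdges I.weight t) :
    ∃ S : Set (Fin n), (∀ x ∈ S, I.graph.dist v x < t) ∧ Xor (v ∈ S) (u ∈ S) ∧
      ∀ x y, I.graph.Adj x y → x ∈ S → y ∉ S → I.weight s(v, u) ≤ I.weight s(x, y) := by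
  simp only [bulkyEdges, Set.mem_ofPred_eq, not_forall, not_le] at he
  obtain ⟨a, ha, hcard⟩ := he
  set L := T.lightPart I.weight Set.univ (I.weight s(v, u)) with hL
  have hnr : ¬ L.Reachable v u :=
    not_reachable_lightPart hT.1.2.isAcyclic hvu (Set.mem_univ _) le_rfl
  refine ⟨{x | L.Reachable a x}, fun x hx => ?_, ?_, fun x y hxy hx hy => ?_⟩
  -- Fewer than `t` vertices gives distance at most `t - 2` from the endpoint `a`, and `v` is at
  -- most one step further.
  · have h1 := Reachable.dist_lt_ncard hx
    have h2 : I.graph.dist a x ≤ L.dist a x :=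
      Reachable.dist_anti ((lightPart_le _).trans hT.1.1) hx
    have h3 := I.connected.dist_triangle (u := v) (v := a) (w := x)
    have h4 : I.graph.dist v a ≤ 1 := by
      rcases Sym2.mem_iff.1 ha with rfl | rfl
      · simp
      · exact (dist_eq_one_iff_adj.2 (hT.1.1 hvu)).le
    omega
  · rcases Sym2.mem_iff.1 ha with rfl | rfl
    · exact Or.inl ⟨Reachable.refl _, hnr⟩
    · exact Or.inr ⟨Reachable.refl _, fun h => hnr (Reachable.symm h)⟩
  · obtain ⟨x', y', h1, h2, h3, h4⟩ := hT.exists_le_of_cut _ hxy hx hy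
    exact (lightPart_boundary h2 h3 h1).2.trans h4

/-- Every instance whose marked edges form a minimum spanning tree has certificates that are
accepted by all nodes and that contain only few and small numbers. -/
theorem exists_locallyMst (hc : 1 ≤ c) (ht : 1 ≤ t) (h : mst c n I) :
    ∃ f : Fin n → MstCertificate, (∀ v, I.LocallyMst t f v) ∧ ∀ v,
      (((f v).root : ℝ) ≤ n ^ c ∧ ((f v).depth : ℝ) ≤ n ^ c ∧ ((f v).cluster : ℝ) ≤ n ^ c ∧
        ∀ m ∈ (f v).cuts, (m : ℝ) ≤ n ^ c) ∧
      (f v).cuts.length ≤ Nat.log 2 n / ((t + 1) / 2) + 1 := by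
  classical
  obtain ⟨r⟩ := I.connected.nonempty
  have hT : I.IsMinTree I.marked := h
  have hTree : I.marked.IsTree := hT.1.2
  set B := I.marked.bulkyEdges I.weight t with hB
  set H := I.marked.lightPart I.weight B 0 with hH
  obtain ⟨S, hSH, hSle, hSB, hSmem, hScard⟩ := hTree.exists_cut_family
    (I.weight_injOn.mono (edgeSet_mono hT.1.1)) B
  have hHG : H ≤ I.graph := (lightPart_le _).trans hT.1.1
  have hSreach : ∀ {x y m}, H.Reachable x y → x ∈ S m → y ∈ S m := by
    rintro x y m ⟨p⟩ hx
    induction p with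
    | nil => exact hx
    | cons hadj _ ih => exact ih (hSH m _ _ hadj hx)
  have hfin : ∀ v, {m | v ∈ S m}.Finite := by
    intro v
    refine (Set.toFinite (I.weight '' I.marked.edgeSet)).subset fun m hm => ?_
    obtain ⟨e, h1, -, h2⟩ := hSmem m v hm
    exact ⟨e, h1, h2⟩
  let Λ : Fin n → Finset ℕ := fun v => (hfin v).toFinset
  have hΛ : ∀ {v m}, m ∈ Λ v ↔ v ∈ S m := fun {v m} => (hfin v).mem_toFinset
  have hΛreach : ∀ {x y}, H.Reachable x y → Λ x = Λ y := fun hxy =>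
    Finset.ext fun m => by rw [hΛ, hΛ]; exact ⟨hSreach hxy, hSreach hxy.symm⟩
  -- The largest `k` for which the colouring radius `2 * (k - 1)` is at most `t - 1`.
  set k := (t + 1) / 2 with hk
  obtain ⟨g, hg, hgcard⟩ := Finset.exists_slices k (by omega)
  obtain ⟨col, hcol⟩ := H.exists_dense_coloring k
  let rep : Fin n → Fin n := fun v => (H.connectedComponentMk v).out
  have hrep : ∀ {x y}, rep x = rep y → H.Reachable x y := by
    intro x y hxy
    refine ConnectedComponent.exact ?_
    rw [← Quot.out_eq (H.connectedComponentMk x), ← Quot.out_eq (H.connectedComponentMk y)]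
    exact congrArg _ hxy
  have hrep' : ∀ {x y}, H.Reachable x y → rep x = rep y := fun hxy => by
    simp only [rep, ConnectedComponent.sound hxy]
  let f : Fin n → MstCertificate := fun v =>
    { root := I.ident r
      depth := I.marked.dist r v
      cluster := I.ident (rep v)
      cuts := ((Λ v).filter (g (Λ v) · = col v)).toList }
  have hcuts : ∀ {v m}, m ∈ I.cuts t f v ↔ v ∈ S m := by
    intro v m
    constructor
    · rintro ⟨y, -, hy, hm⟩
      have hm : m ∈ Λ y := (Finset.mem_filter.1 (Finset.mem_toList.1 hm)).1
      exact hSreach (hrep (I.ident_injective hy)) (hΛ.1 hm)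
    · intro hm
      -- A cut containing `v` comes from a bulky edge, so the cluster of `v` has at least `t ≥ k`
      -- vertices and all colours occur near `v`.
      obtain ⟨e, -, heB, -⟩ := hSmem m v hm
      have hbig := le_ncard_of_mem_bulkyEdges hTree.connected heB v
      obtain ⟨y, hvy, hd, hcy⟩ := hcol v (le_trans (by omega) hbig) (g (Λ v) m) (hg _ _)
      refine ⟨y, ?_, congrArg I.ident (hrep' hvy.symm), ?_⟩
      · have := Reachable.dist_anti hHG hvy
        omega
      · refine Finset.mem_toList.2 (Finset.mem_filter.2 ⟨?_, ?_⟩)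
        · exact hΛ.2 (hSreach hvy hm)
        · rw [← hΛreach hvy, hcy]
  have hn : (1 : ℝ) ≤ n := by exact_mod_cast r.pos
  have hnc : (n : ℝ) ≤ n ^ c := Real.self_le_rpow_of_one_le hn hc
  refine ⟨f, fun v => ⟨fun u _ => rfl, fun hd => ?_, fun u hu => ?_, fun hd => ?_,
    fun u hu m hm hm' => ?_, fun u hu => ?_⟩, fun v => ⟨⟨I.ident_le r, ?_, I.ident_le _, ?_⟩, ?_⟩⟩
  · exact congrArg I.ident (hTree.connected.dist_eq_zero_iff.1 hd)
  · rcases hTree.dist_eq_dist_add_one_of_adj r hu with h | h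
    · exact Or.inl h.symm
    · exact Or.inr h
  · exact hTree.existsUnique_parent r hd
  -- The cut family controls tree edges only; minimality of the tree extends the bound to all graph
  -- edges leaving the cut.
  · obtain ⟨x, y, hxy, hx, hy, hle⟩ :=
      hT.exists_le_of_cut (S m) hu (hcuts.1 hm) fun h => hm' (hcuts.2 h)
    exact (hSle m x y hxy hx hy).trans hle
  · by_cases he : s(v, u) ∈ B
    · left
      rw [hcuts, hcuts]
      exact hSB v u hu he
    · exact Or.inr (hT.exists_local_cut hu he)
  · have h1 := (hTree.connected r v).dist_lt_ncard.le.trans (Set.ncard_le_card _)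
    rw [Nat.card_eq_fintype_card, Fintype.card_fin] at h1
    exact le_trans (by exact_mod_cast h1) hnc
  · intro m hm
    have hm : m ∈ Λ v := (Finset.mem_filter.1 (Finset.mem_toList.1 hm)).1
    obtain ⟨e, he, -, rfl⟩ := hSmem m v (hΛ.1 hm)
    exact I.weight_le e (edgeSet_mono hT.1.1 he)
  · rw [Finset.length_toList]
    refine (hgcard _ _).trans (Nat.succ_le_succ (Nat.div_le_div_right ?_))
    have h1 := hScard v (Λ v) fun m hm => hΛ.1 hm
    rw [Nat.card_eq_fintype_card, Fintype.card_fin] at h1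
    exact Nat.le_log_of_pow_le (by norm_num) h1

/-- The certificates of an instance that satisfies the predicate, as bit strings. -/
theorem exists_acceptsMst (hc : 1 ≤ c) (ht : 1 ≤ t) (h : mst c n I) :
    ∃ cert : Fin n → List Bool, (∀ v, (I.view t cert v).AcceptsMst t) ∧
      ∀ v, (cert v).length ≤
        (Nat.log 2 n / ((t + 1) / 2) + 4) * (2 * (⌊c * Real.logb 2 n⌋₊ + 1) + 1) := by
  obtain ⟨f, hf, hle⟩ := exists_locallyMst hc ht h
  obtain ⟨r⟩ := I.connected.nonempty
  have hn : (0 : ℝ) < n := by exact_mod_cast r.pos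
  have hsize : ∀ m : ℕ, (m : ℝ) ≤ n ^ c → m.size ≤ ⌊c * Real.logb 2 n⌋₊ + 1 := by
    intro m hm
    rw [Nat.size_le]
    have h1 : (n : ℝ) ^ c = 2 ^ (c * Real.logb 2 n) := by
      rw [mul_comm, Real.rpow_mul (by norm_num), Real.rpow_logb (by norm_num) (by norm_num) hn]
    have h2 : (n : ℝ) ^ c < 2 ^ ((⌊c * Real.logb 2 n⌋₊ + 1 : ℕ) : ℝ) := by
      rw [h1]
      refine Real.rpow_lt_rpow_of_exponent_lt (by norm_num) ?_
      push_cast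
      exact Nat.lt_floor_add_one _
    rw [Real.rpow_natCast] at h2
    exact_mod_cast hm.trans_lt h2
  refine ⟨fun v => (f v).encode, fun v => ?_, fun v => ?_⟩
  · rw [acceptsMst_view_iff ht]
    simpa only [MstCertificate.decode_encode] using hf v
  · obtain ⟨⟨h1, h2, h3, h4⟩, h5⟩ := hle v
    refine (MstCertificate.length_encode_le (f v) (hsize _ h1) (hsize _ h2) (hsize _ h3)
      fun m hm => hsize m (h4 m hm)).trans (Nat.mul_le_mul_right _ ?_)
    omega

end NetInstance

/-! ### The scheme and its certificate size -/

open Classical in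
/-- The proof-labeling scheme for minimum spanning trees. -/
noncomputable def mstScheme {c : ℝ} (hc : 1 ≤ c) {t : ℕ} (ht : 1 ≤ t) :
    ProofLabelingScheme (mst c) t where
  prover _ I := if h : mst c _ I then (NetInstance.exists_acceptsMst hc ht h).choose
    else fun _ => []
  verifier V := V.AcceptsMst t
  complete n I h v := by
    rw [dif_pos h]
    exact (NetInstance.exists_acceptsMst hc ht h).choose_spec.1 v
  sound n I h cert := by
    by_contra hcon
    push Not at hcon
    exact h (NetInstance.mst_of_locallyMst fun v =>
      (NetInstance.acceptsMst_view_iff ht).1 (hcon v))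

theorem mstScheme_length_le {c : ℝ} (hc : 1 ≤ c) {t : ℕ} (ht : 1 ≤ t) {n : ℕ}
    {I : NetInstance c n} (h : mst c n I) (v : Fin n) :
    ((mstScheme hc ht).prover n I v).length ≤
      (Nat.log 2 n / ((t + 1) / 2) + 4) * (2 * (⌊c * Real.logb 2 n⌋₊ + 1) + 1) := by
  have hp : (mstScheme hc ht).prover n I = (NetInstance.exists_acceptsMst hc ht h).choose :=
    dif_pos h
  rw [hp]
  exact (NetInstance.exists_acceptsMst hc ht h).choose_spec.2 v

theorem theorem6 (c : ℝ) (hc : 1 ≤ c) (a : ℝ) (ha : 0 < a) :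
    ∃ C : ℝ, 0 < C ∧ ∀ t : ℕ, 1 ≤ t →
      ∃ S : ProofLabelingScheme (mst c) t, ∀ n : ℕ, (t : ℝ) ≤ a * Real.log n →
        S.SizeAtMost n (C * Real.log n ^ 2 / t) := by
  have hl2 : 0 < Real.log 2 := Real.log_pos (by norm_num)
  refine ⟨(2 / Real.log 2 + 4 * a) * ((2 * c + 3) / Real.log 2), by positivity, fun t ht =>
    ⟨mstScheme hc ht, fun n htn I hI v => ?_⟩⟩
  have ht0 : (0 : ℝ) < t := by exact_mod_cast ht
  have hlog : 0 < Real.log n := pos_of_mul_pos_right (ht0.trans_le htn) ha.le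
  have hn : 2 ≤ n := by
    by_contra hlt
    interval_cases n <;> simp at hlog
  have hb : 1 ≤ Real.logb 2 n := by
    rw [Real.le_logb_iff_rpow_le (by norm_num) (by positivity)]
    simpa using (by exact_mod_cast hn : (2 : ℝ) ≤ n)
  have h1 : ((Nat.log 2 n / ((t + 1) / 2) : ℕ) : ℝ) ≤ Real.logb 2 n / (t / 2) := by
    have hk : (t : ℝ) / 2 ≤ ((t + 1) / 2 : ℕ) := by
      have : t ≤ (t + 1) / 2 * 2 := by omega
      have : (t : ℝ) ≤ ((t + 1) / 2 : ℕ) * 2 := by exact_mod_cast this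
      linarith
    refine Nat.cast_div_le.trans ?_
    exact div_le_div₀ (by linarith) (by simpa using Real.natLog_le_logb n 2) (by positivity) hk
  have h2 : (⌊c * Real.logb 2 n⌋₊ : ℝ) ≤ c * Real.logb 2 n := Nat.floor_le (by positivity)
  have h3 : ((Nat.log 2 n / ((t + 1) / 2) + 4 : ℕ) : ℝ)
      ≤ (2 / Real.log 2 + 4 * a) * (Real.log n / t) := by
    -- The only quantitative use of `t ≤ a log n`: it absorbs the constant 4, that is, the three
    -- fixed fields and the rounding of the slices.
    have h4 : (1 : ℝ) ≤ a * (Real.log n / t) := by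
      rw [← mul_div_assoc, le_div_iff₀ ht0]; linarith
    have h5 : Real.logb 2 n / (t / 2) = 2 / Real.log 2 * (Real.log n / t) := by
      rw [Real.logb]; field_simp
    rw [h5] at h1
    rw [Nat.cast_add]
    norm_num
    linarith
  have h4 : ((2 * (⌊c * Real.logb 2 n⌋₊ + 1) + 1 : ℕ) : ℝ)
      ≤ (2 * c + 3) / Real.log 2 * Real.log n := by
    have h5 : (2 * c + 3) / Real.log 2 * Real.log n = (2 * c + 3) * Real.logb 2 n := by
      rw [Real.logb]; ring
    rw [h5]
    push_cast
    linarith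
  calc (((mstScheme hc ht).prover n I v).length : ℝ)
      ≤ ((Nat.log 2 n / ((t + 1) / 2) + 4 : ℕ) : ℝ) *
          ((2 * (⌊c * Real.logb 2 n⌋₊ + 1) + 1 : ℕ) : ℝ) := by
        exact_mod_cast mstScheme_length_le hc ht hI v
    _ ≤ (2 / Real.log 2 + 4 * a) * (Real.log n / t) *
          ((2 * c + 3) / Real.log 2 * Real.log n) :=
        mul_le_mul h3 h4 (by positivity) (by positivity)
    _ = _ := by ring
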